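/- Let $p$ be a prime and let $G$ be a finite $p$-group with $|G:G'| = p^2$ and $|G| \ge p^6$. Write $\gamma_1(G) = G$ and $\gamma_{i+1}(G) = [\gamma_i(G), G]$ for the terms of the lower central series, so that $G' = \gamma_2(G)$. Then the conditions $|\gamma_3(G):\gamma_4(G)| > p$ and $|G:\gamma_4(G)| = p^5$ are equivalent, and if they hold, then $G$ has an irreducible complex character of degree exactly $p^2$. -/

import Mathlib

/-- `χ : G → ℂ` is an irreducible (complex) character of `G`: the trace function of an irreducible
representation of `G` on a finite-dimensional complex vector space, which after a choice of basis
is `ℂⁿ` for some `n`. The degree of `χ` is `χ 1`. -/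
def IsIrreducibleCharacter {G : Type*} [Group G] (χ : G → ℂ) : Prop :=
  ∃ (n : ℕ) (ρ : Representation ℂ G (Fin n → ℂ)), ρ.IsIrreducible ∧ ρ.character = χ

/-- The lower central series in the usual numbering, `γ₁(G) = G` and `γᵢ₊₁(G) = [γᵢ(G), G]` for
`i ≥ 1` (Mathlib's series starts with index `0`). -/
def lowerCentralTerm (G : Type*) [Group G] (i : ℕ) : Subgroup G :=
  (⊤ : Subgroup G).lowerCentralSeries (i - 1)

/-!
Write `γᵢ` for the terms of the lower central series. As `γ₂` has index `p²`, the section `γ₂/γ₃`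
is generated by a single commutator and has order at most `p`. For `c ∈ γ₂ \ γ₃` the map
`g ↦ ⁅c, g⁆` is a homomorphism from `G` onto `γ₃/γ₄` whose kernel contains `γ₂`, so
`|γ₃ : γ₄|` divides `p²`; if it exceeds `p`, the kernel is exactly `γ₂`.

For the character it suffices to find a linear character of `γ₂` whose stabilizer in `G` is `γ₂`:
it induces an irreducible character of degree `|G : γ₂| = p²`. Since `γ₂` is abelian modulo `γ₅`,
there is a linear character `ν` of `γ₂` that is nontrivial on `γ₄`. If its stabilizer contains some
`m ∉ γ₂`, then `⁅c, m⁆ ∉ γ₄` and there is a linear character `θ` trivial on `γ₄` but not at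
`⁅c, m⁆`, so `m` does not stabilize `θ`. The stabilizers `S` of `ν` and `T` of `θν` cannot
generate `G`, since otherwise `γ₄ = [γ₂, S, G][γ₂, T, G]`, on which `ν` is trivial. If `T`
were larger than `γ₂` too, then `S` and `T` would both be maximal of index `p`, hence equal, and `m`
would stabilize `θ`.
-/

open scoped commutatorElement

section CentralizerMod

variable {G : Type*} [Group G]

/-- The elements of `G` that commute with every element of `S` modulo the normal subgroup `N`. -/
def centralizerMod (N : Subgroup G) [N.Normal] (S : Set G) : Subgroup G :=
  (Subgroup.centralizer (S.image (QuotientGroup.mk' N))).comap (QuotientGroup.mk' N)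

variable {N : Subgroup G}

theorem commutatorElement_mem_comm {g h : G} : ⁅g, h⁆ ∈ N ↔ ⁅h, g⁆ ∈ N := by
  rw [← commutatorElement_inv, inv_mem_iff]

variable [N.Normal]

theorem mem_centralizerMod {S : Set G} {g : G} : g ∈ centralizerMod N S ↔ ∀ s ∈ S, ⁅s, g⁆ ∈ N := by
  simp only [centralizerMod, Subgroup.mem_comap, Subgroup.mem_centralizer_iff_commutator_eq_one,
    Set.forall_mem_image, ← map_commutatorElement, ← MonoidHom.mem_ker, QuotientGroup.ker_mk']

theorem mem_centralizerMod_singleton {c g : G} : g ∈ centralizerMod N {c} ↔ ⁅c, g⁆ ∈ N := by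
  simp only [mem_centralizerMod, Set.mem_singleton_iff, forall_eq]

theorem subset_centralizerMod_comm {S T : Set G} :
    S ⊆ centralizerMod N T ↔ T ⊆ centralizerMod N S := by
  simp only [Set.subset_def, SetLike.mem_coe, mem_centralizerMod]
  rw [forall₂_comm]
  simp only [commutatorElement_mem_comm]

theorem le_centralizerMod_iff {H K : Subgroup G} : K ≤ centralizerMod N H ↔ ⁅H, K⁆ ≤ N := by
  rw [Subgroup.commutator_le, forall₂_comm]
  exact forall₂_congr fun _ _ => mem_centralizerMod

theorem le_centralizerMod_top_iff {K : Subgroup G} :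
    K ≤ centralizerMod N (⊤ : Subgroup G) ↔ ⁅K, ⊤⁆ ≤ N := by
  rw [le_centralizerMod_iff, Subgroup.commutator_comm]

theorem le_centralizerMod (S : Set G) : N ≤ centralizerMod N S := fun _ hn =>
  mem_centralizerMod.mpr fun s _ => Subgroup.commutator_le_right ⊤ N
    (Subgroup.commutator_mem_commutator (Subgroup.mem_top s) hn)

theorem normal_of_le_centralizerMod_top {J : Subgroup G} (hNJ : N ≤ J)
    (hJ : J ≤ centralizerMod N (⊤ : Subgroup G)) : J.Normal :=
  Subgroup.commutator_top_right_le_iff.mp ((le_centralizerMod_top_iff.mp hJ).trans hNJ)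

theorem commutator_sup_right (H K L : Subgroup G) [H.Normal] [K.Normal] [L.Normal] :
    ⁅H, K ⊔ L⁆ = ⁅H, K⁆ ⊔ ⁅H, L⁆ :=
  le_antisymm
    (le_centralizerMod_iff.mp (sup_le (le_centralizerMod_iff.mpr le_sup_left)
      (le_centralizerMod_iff.mpr le_sup_right)))
    (sup_le (Subgroup.commutator_mono le_rfl le_sup_left)
      (Subgroup.commutator_mono le_rfl le_sup_right))

theorem commutator_sup_left (H K L : Subgroup G) [H.Normal] [K.Normal] [L.Normal] :
    ⁅K ⊔ L, H⁆ = ⁅K, H⁆ ⊔ ⁅L, H⁆ := by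
  simp only [Subgroup.commutator_comm _ H, commutator_sup_right]

theorem commutator_commutator_le_of_rotate {H₁ H₂ H₃ : Subgroup G}
    (h1 : ⁅⁅H₂, H₃⁆, H₁⁆ ≤ N) (h2 : ⁅⁅H₃, H₁⁆, H₂⁆ ≤ N) : ⁅⁅H₁, H₂⁆, H₃⁆ ≤ N := by
  rw [← QuotientGroup.ker_mk' N, ← Subgroup.map_eq_bot_iff, Subgroup.map_commutator,
    Subgroup.map_commutator] at h1 h2 ⊢
  exact Subgroup.commutator_commutator_eq_bot_of_rotate h1 h2

/-- The homomorphism `g ↦ ⁅c, g⁆` modulo `N`, for `c` such that all `⁅c, g⁆` are central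
modulo `N`. -/
def commutatorHomMod (N : Subgroup G) [N.Normal] (c : G)
    (hc : ∀ g, ⁅c, g⁆ ∈ centralizerMod N (⊤ : Subgroup G)) : G →* G ⧸ N where
  toFun g := QuotientGroup.mk' N ⁅c, g⁆
  map_one' := by simp
  map_mul' g h := by
    have hcomm : Commute (QuotientGroup.mk' N g) (QuotientGroup.mk' N ⁅c, h⁆) :=
      hc h _ ⟨g, Set.mem_univ g, rfl⟩
    rw [commutatorElement_mul_right_eq_mul_conj, mul_assoc _ g, mul_assoc, mul_assoc, map_mul,
      map_mul, map_mul, map_inv, ← mul_assoc _ _ (_⁻¹), hcomm.eq, mul_inv_cancel_right]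

variable {c : G}

theorem ker_commutatorHomMod (hc : ∀ g, ⁅c, g⁆ ∈ centralizerMod N (⊤ : Subgroup G)) :
    (commutatorHomMod N c hc).ker = centralizerMod N {c} := by
  ext g
  rw [mem_centralizerMod_singleton]
  exact QuotientGroup.eq_one_iff _

theorem relIndex_closure_range_commutatorElement
    (hc : ∀ g, ⁅c, g⁆ ∈ centralizerMod N (⊤ : Subgroup G)) :
    N.relIndex (Subgroup.closure (Set.range (⁅c, ·⁆))) = (centralizerMod N {c}).index := by
  have hrange : (Subgroup.closure (Set.range (⁅c, ·⁆))).map (QuotientGroup.mk' N) =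
      (commutatorHomMod N c hc).range := by
    rw [MonoidHom.map_closure, ← Set.range_comp,
      ← Subgroup.closure_eq (commutatorHomMod N c hc).range, MonoidHom.coe_range]
    rfl
  rw [← ker_commutatorHomMod hc, Subgroup.index_ker, ← hrange, ← Subgroup.relIndex_ker,
    QuotientGroup.ker_mk']

/-- The last hypothesis says that, as a normal subgroup, `K` is generated modulo `N` by the
commutators `⁅c, g⁆`. -/
theorem relIndex_eq_index_centralizerMod_singleton {K : Subgroup G} (hcK : ∀ g, ⁅c, g⁆ ∈ K)
    (hK : ⁅K, ⊤⁆ ≤ N)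
    (hgen : ∀ (J : Subgroup G) [J.Normal], N ≤ J → c ∈ centralizerMod J (⊤ : Subgroup G) → K ≤ J) :
    N.relIndex K = (centralizerMod N {c}).index := by
  have hcentral : K ≤ centralizerMod N (⊤ : Subgroup G) := le_centralizerMod_top_iff.mpr hK
  set C : Subgroup G := Subgroup.closure (Set.range (⁅c, ·⁆))
  have hCK : C ≤ K := (Subgroup.closure_le K).mpr (Set.range_subset_iff.mpr hcK)
  have hnormal : (N ⊔ C).Normal := normal_of_le_centralizerMod_top le_sup_left
    (sup_le (le_centralizerMod _) (hCK.trans hcentral))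
  have hKC : K ≤ N ⊔ C := by
    refine hgen _ le_sup_left (mem_centralizerMod.mpr fun g _ => commutatorElement_mem_comm.mp ?_)
    exact le_sup_right (a := N) (Subgroup.subset_closure (Set.mem_range_self g))
  have hNK : N ⊔ K = N ⊔ C := le_antisymm (sup_le le_sup_left hKC) (sup_le_sup_left hCK N)
  rw [← relIndex_closure_range_commutatorElement fun g => hcentral (hcK g),
    ← Subgroup.relIndex_sup_left K, hNK, Subgroup.relIndex_sup_left]

end CentralizerMod

section PrimeIndex

variable {G : Type*} [Group G] {p : ℕ}

theorem le_of_relIndex_prime {H K L : Subgroup G} (hp : (H.relIndex L).Prime) (hHK : H ≤ K)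
    {c : G} (hcL : c ∈ L) (hcK : c ∈ K) (hcH : c ∉ H) : L ≤ K := by
  have hdvd : K.relIndex L ∣ H.relIndex L := Subgroup.relIndex_dvd_of_le_left L hHK
  rcases hp.eq_one_or_self_of_dvd _ hdvd with hone | hself
  · exact Subgroup.relIndex_eq_one.mp hone
  · have hmul := Subgroup.relIndex_inf_mul_relIndex H K L
    rw [inf_eq_left.mpr hHK, hself, Nat.mul_eq_right hp.ne_zero, Subgroup.relIndex_eq_one] at hmul
    exact absurd (hmul ⟨hcK, hcL⟩) hcH

theorem eq_top_of_index_prime {H K : Subgroup G} (hp : H.index.Prime) (hHK : H < K) : K = ⊤ := by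
  obtain ⟨hle, c, hcK, hcH⟩ := SetLike.lt_iff_le_and_exists.mp hHK
  rw [← Subgroup.relIndex_top_right] at hp
  exact top_le_iff.mp (le_of_relIndex_prime hp hle (Subgroup.mem_top c) hcK hcH)

theorem eq_of_le_of_index_eq {H K : Subgroup G} (hHK : H ≤ K) (hindex : H.index = K.index)
    (hK : K.index ≠ 0) : H = K := by
  have hmul := Subgroup.relIndex_mul_index hHK
  rw [hindex, Nat.mul_eq_right hK] at hmul
  exact le_antisymm hHK (Subgroup.relIndex_eq_one.mp hmul)

theorem eq_top_or_index_eq_of_index_sq (hp : p.Prime) {H K : Subgroup G} (hH : H.index = p ^ 2)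
    (hHK : H < K) : K = ⊤ ∨ K.index = p := by
  obtain ⟨k, hk, hKk⟩ := (Nat.dvd_prime_pow hp).mp (hH ▸ Subgroup.index_dvd_of_le hHK.le)
  interval_cases k
  · exact Or.inl (Subgroup.index_eq_one.mp hKk)
  · exact Or.inr (hKk.trans (pow_one p))
  · have hK : K.index ≠ 0 := hKk ▸ pow_ne_zero 2 hp.ne_zero
    exact absurd (eq_of_le_of_index_eq hHK.le (hH.trans hKk.symm) hK) hHK.ne

variable {N : Subgroup G} [N.Normal]

/-- A group with cyclic quotient by a central subgroup is abelian, here `K` modulo `N`. -/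
theorem commutator_self_le_of_relIndex_prime {K L : Subgroup G} (hp : (L.relIndex K).Prime)
    (hKL : ⁅K, L⁆ ≤ N) : ⁅K, K⁆ ≤ N := by
  obtain ⟨c, hcK, hcL⟩ := SetLike.not_le_iff_exists.mp (mt Subgroup.relIndex_eq_one.mpr hp.ne_one)
  have hL : L ≤ centralizerMod N K := le_centralizerMod_iff.mpr hKL
  have hc : K ≤ centralizerMod N {c} :=
    le_of_relIndex_prime hp (hL.trans fun _ hg => mem_centralizerMod_singleton.mpr
      (mem_centralizerMod.mp hg c hcK)) hcK
      (mem_centralizerMod_singleton.mpr (by simp)) hcL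
  exact le_centralizerMod_iff.mp (le_of_relIndex_prime hp hL hcK
    (Set.singleton_subset_iff.mp (subset_centralizerMod_comm.mp hc)) hcL)

end PrimeIndex

section LowerCentralSeries

variable {G : Type*} [Group G] {p : ℕ}

theorem relIndex_commutator_of_index_commutator (hp : p.Prime)
    (hG' : (commutator G).index = p ^ 2) {N : Subgroup G} [N.Normal] (hN : ⁅commutator G, ⊤⁆ ≤ N)
    (hNG : ¬ commutator G ≤ N) : N.relIndex (commutator G) = p := by
  have hne : commutator G ≠ ⊤ := by
    rw [ne_eq, ← Subgroup.index_eq_one, hG']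
    exact (Nat.one_lt_pow two_ne_zero hp.one_lt).ne'
  obtain ⟨x, -, hx⟩ := SetLike.exists_of_lt hne.lt_top
  have hdichotomy (K : Subgroup G) (hK : commutator G ≤ K) (hxK : x ∈ K) : K = ⊤ ∨ K.index = p :=
    eq_top_or_index_eq_of_index_sq hp hG' (SetLike.lt_iff_le_and_exists.mpr ⟨hK, x, hxK, hx⟩)
  have hgen (J : Subgroup G) [J.Normal] (hNJ : N ≤ J)
      (hxJ : x ∈ centralizerMod J (⊤ : Subgroup G)) : commutator G ≤ J := by
    rcases hdichotomy _ (le_centralizerMod_top_iff.mpr (hN.trans hNJ)) hxJ with htop | hprime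
    · exact le_centralizerMod_top_iff.mp htop.ge
    · refine commutator_self_le_of_relIndex_prime
        (L := centralizerMod J (⊤ : Subgroup G)) ?_ (le_centralizerMod_iff.mp le_rfl)
      rwa [Subgroup.relIndex_top_right, hprime]
  have hindex : N.relIndex (commutator G) = (centralizerMod N {x}).index :=
    relIndex_eq_index_centralizerMod_singleton (fun g => Subgroup.commutator_mem_commutator
      (Subgroup.mem_top x) (Subgroup.mem_top g)) hN hgen
  have hcomm : commutator G ≤ centralizerMod N {x} := fun a ha =>
    mem_centralizerMod_singleton.mpr <| commutatorElement_mem_comm.mp <|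
      hN (Subgroup.commutator_mem_commutator ha (Subgroup.mem_top x))
  refine hindex.trans ((hdichotomy _ hcomm ?_).resolve_left fun htop => hNG (hgen N le_rfl ?_))
  · exact mem_centralizerMod_singleton.mpr (by simp)
  · exact Set.singleton_subset_iff.mp (subset_centralizerMod_comm.mp htop.ge)

theorem relIndex_commutator_top_eq_index_centralizerMod {A B N : Subgroup G} [N.Normal]
    (hAB : B = ⁅A, ⊤⁆) (hBN : ⁅B, ⊤⁆ ≤ N) (hprime : (B.relIndex A).Prime) {c : G}
    (hcA : c ∈ A) (hcB : c ∉ B) : N.relIndex B = (centralizerMod N {c}).index := by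
  refine relIndex_eq_index_centralizerMod_singleton
    (fun g => hAB.ge (Subgroup.commutator_mem_commutator hcA (Subgroup.mem_top g))) hBN
    fun J _ hNJ hcJ => hAB.le.trans (le_centralizerMod_top_iff.mp ?_)
  exact le_of_relIndex_prime hprime (le_centralizerMod_top_iff.mpr (hBN.trans hNJ)) hcA hcJ hcB

theorem commutator_commutator_le_commutator_commutator_top (K : Subgroup G) [K.Normal] :
    ⁅commutator G, K⁆ ≤ ⁅⁅K, (⊤ : Subgroup G)⁆, ⊤⁆ :=
  commutator_commutator_le_of_rotate (H₁ := ⊤) (H₂ := ⊤)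
    (Subgroup.commutator_mono (Subgroup.commutator_comm_le ⊤ K) le_rfl) le_rfl

theorem commutator_top_ne_self [Group.IsNilpotent G] {H : Subgroup G} (hH : H ≠ ⊥) :
    ⁅H, (⊤ : Subgroup G)⁆ ≠ H := by
  intro hfix
  obtain ⟨n, hn⟩ := Subgroup.nilpotent_iff_lowerCentralSeries.mp ‹Group.IsNilpotent G›
  have hle (m : ℕ) : H ≤ (⊤ : Subgroup G).lowerCentralSeries m := by
    induction m with
    | zero => exact le_top
    | succ m ih => exact hfix.ge.trans (Subgroup.commutator_mono ih le_rfl)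
  exact hH (le_bot_iff.mp ((hle n).trans hn.le))

local notation "γ" => lowerCentralTerm G

instance lowerCentralTerm_normal (n : ℕ) : (γ n).Normal :=
  Subgroup.lowerCentralSeries_normal ⊤ (n - 1)

theorem lowerCentralTerm_antitone : Antitone (lowerCentralTerm G) := fun _ _ hmn =>
  (⊤ : Subgroup G).lowerCentralSeries_antitone (Nat.sub_le_sub_right hmn 1)

theorem commutator_lowerCentralTerm_two_le (hprime : ((γ 3).relIndex (γ 2)).Prime) :
    ⁅γ 2, γ 2⁆ ≤ γ 5 :=
  commutator_self_le_of_relIndex_prime hprime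
    (commutator_commutator_le_commutator_commutator_top (γ 3))

theorem relIndex_lowerCentralTerm_three_two (hp : p.Prime) (hG' : (commutator G).index = p ^ 2)
    (hlt : γ 3 < γ 2) : (γ 3).relIndex (γ 2) = p :=
  relIndex_commutator_of_index_commutator hp hG' le_rfl hlt.not_ge

theorem relIndex_lowerCentralTerm_four_three (hprime : ((γ 3).relIndex (γ 2)).Prime) {c : G}
    (hc : c ∈ γ 2) (hc' : c ∉ γ 3) : (γ 4).relIndex (γ 3) = (centralizerMod (γ 4) {c}).index :=
  relIndex_commutator_top_eq_index_centralizerMod rfl le_rfl hprime hc hc'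

theorem lowerCentralTerm_two_le_centralizerMod (hprime : ((γ 3).relIndex (γ 2)).Prime) {c : G}
    (hc : c ∈ γ 2) : γ 2 ≤ centralizerMod (γ 4) {c} := fun _ hg =>
  mem_centralizerMod_singleton.mpr <| lowerCentralTerm_antitone (by decide) <|
    commutator_lowerCentralTerm_two_le hprime (Subgroup.commutator_mem_commutator hc hg)

theorem relIndex_lowerCentralTerm_four_three_dvd (hp : p.Prime)
    (hG' : (commutator G).index = p ^ 2) (hlt : γ 3 < γ 2) : (γ 4).relIndex (γ 3) ∣ p ^ 2 := by
  obtain ⟨-, c, hc, hc'⟩ := SetLike.lt_iff_le_and_exists.mp hlt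
  have hprime := (relIndex_lowerCentralTerm_three_two hp hG' hlt).symm ▸ hp
  rw [relIndex_lowerCentralTerm_four_three hprime hc hc', ← hG']
  exact Subgroup.index_dvd_of_le (lowerCentralTerm_two_le_centralizerMod hprime hc)

theorem index_lowerCentralTerm_four (hp : p.Prime) (hG' : (commutator G).index = p ^ 2)
    (hlt : γ 3 < γ 2) : (γ 4).index = (γ 4).relIndex (γ 3) * p ^ 3 := by
  have h43 : γ 4 ≤ γ 3 := lowerCentralTerm_antitone (by decide)
  rw [← Subgroup.relIndex_mul_index h43, ← Subgroup.relIndex_mul_index hlt.le,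
    relIndex_lowerCentralTerm_three_two hp hG' hlt, pow_succ' p 2, ← hG']
  rfl

theorem lowerCentralTerm_three_lt_two (hne : γ 4 ≠ γ 2) : γ 3 < γ 2 := by
  refine lt_of_le_of_ne (lowerCentralTerm_antitone (by decide)) fun heq => hne ?_
  calc γ 4 = ⁅γ 3, ⊤⁆ := rfl
    _ = ⁅γ 2, ⊤⁆ := by rw [heq]
    _ = γ 2 := heq

theorem lowerCentralTerm_three_lt_two_of_lt_relIndex (hp : p.Prime)
    (hlt : p < (γ 4).relIndex (γ 3)) : γ 3 < γ 2 := by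
  refine lowerCentralTerm_three_lt_two fun heq => hlt.not_ge ?_
  have hone : (γ 4).relIndex (γ 3) = 1 :=
    Subgroup.relIndex_eq_one.mpr (heq ▸ lowerCentralTerm_antitone (by decide))
  exact hone.trans_le hp.one_le

theorem relIndex_lowerCentralTerm_four_three_eq_sq (hp : p.Prime)
    (hG' : (commutator G).index = p ^ 2) (hlt : p < (γ 4).relIndex (γ 3)) :
    (γ 4).relIndex (γ 3) = p ^ 2 := by
  obtain ⟨k, hk, hrel⟩ := (Nat.dvd_prime_pow hp).mp (relIndex_lowerCentralTerm_four_three_dvd hp hG'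
    (lowerCentralTerm_three_lt_two_of_lt_relIndex hp hlt))
  have hk' : 1 < k := (Nat.pow_lt_pow_iff_right hp.one_lt).mp ((pow_one p).trans_lt (hrel ▸ hlt))
  rw [hrel, Nat.le_antisymm hk hk']

theorem lt_relIndex_lowerCentralTerm_iff (hp : p.Prime) (hG' : (commutator G).index = p ^ 2) :
    p < (γ 4).relIndex (γ 3) ↔ (γ 4).index = p ^ 5 := by
  constructor
  · intro hlt
    rw [index_lowerCentralTerm_four hp hG' (lowerCentralTerm_three_lt_two_of_lt_relIndex hp hlt),
      relIndex_lowerCentralTerm_four_three_eq_sq hp hG' hlt, ← pow_add]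
  · intro hindex
    have hne : γ 4 ≠ γ 2 := fun heq => absurd (Nat.pow_right_injective hp.two_le
      (hindex.symm.trans ((congrArg Subgroup.index heq).trans hG'))) (by decide)
    rw [index_lowerCentralTerm_four hp hG' (lowerCentralTerm_three_lt_two hne),
      show p ^ 5 = p ^ 2 * p ^ 3 from pow_add p 2 3] at hindex
    rw [Nat.mul_right_cancel (pow_pos hp.pos 3) hindex]
    exact lt_self_pow₀ hp.one_lt one_lt_two

theorem centralizerMod_lowerCentralTerm_four_eq (hp : p.Prime)
    (hG' : (commutator G).index = p ^ 2) (hlt : p < (γ 4).relIndex (γ 3)) {c : G} (hc : c ∈ γ 2)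
    (hc' : c ∉ γ 3) : centralizerMod (γ 4) {c} = γ 2 := by
  have hprime : ((γ 3).relIndex (γ 2)).Prime := (relIndex_lowerCentralTerm_three_two hp hG'
    (lowerCentralTerm_three_lt_two_of_lt_relIndex hp hlt)).symm ▸ hp
  have hindex : (centralizerMod (γ 4) {c}).index = p ^ 2 := by
    rw [← relIndex_lowerCentralTerm_four_three hprime hc hc',
      relIndex_lowerCentralTerm_four_three_eq_sq hp hG' hlt]
  exact (eq_of_le_of_index_eq (lowerCentralTerm_two_le_centralizerMod hprime hc)
    (hG'.trans hindex.symm) (hindex ▸ pow_ne_zero 2 hp.ne_zero)).symm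

end LowerCentralSeries

section LinearCharacterStabilizer

variable {G M : Type*} [Group G] {A : Subgroup G} [A.Normal]

section MulOneClass

variable [MulOneClass M]

/-- The stabilizer in `G` of a linear character `μ` of the normal subgroup `A`, for the action of
`G` by conjugation. -/
def linearCharacterStabilizer (μ : A →* M) : Subgroup G where
  carrier := {g | ∀ a, μ (MulAut.conjNormal g a) = μ a}
  one_mem' a := by rw [map_one, MulAut.one_apply]
  mul_mem' hg hh a := by rw [map_mul, MulAut.mul_apply, hg, hh]
  inv_mem' {g} hg a := by rw [← hg, ← MulAut.mul_apply, ← map_mul, mul_inv_cancel, map_one,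
    MulAut.one_apply]

theorem commutator_linearCharacterStabilizer_le (μ : A →* M) :
    ⁅A, linearCharacterStabilizer μ⁆ ≤ μ.ker.map A.subtype := by
  refine Subgroup.commutator_le.mpr fun a ha g hg => ?_
  have hcomm : ⁅a, g⁆ = A.subtype (⟨a, ha⟩ * MulAut.conjNormal g ⟨a, ha⟩⁻¹) := by
    simp [commutatorElement_def, mul_assoc]
  rw [hcomm]
  refine Subgroup.mem_map_of_mem _ (MonoidHom.mem_ker.mpr ?_)
  rw [map_mul, hg, ← map_mul, mul_inv_cancel, map_one]

end MulOneClass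

theorem le_linearCharacterStabilizer [CommGroup M] (μ : A →* M) :
    A ≤ linearCharacterStabilizer μ := fun a ha b => by
  have hconj : MulAut.conjNormal a b = ⟨a, ha⟩ * b * ⟨a, ha⟩⁻¹ := by
    ext
    simp
  rw [hconj, map_mul, map_mul, map_inv, mul_inv_cancel_comm]

theorem commutator_commutator_top_le_ker [CommGroup M] (hA : commutator G ≤ A) {μ ν : A →* M}
    (hsup : linearCharacterStabilizer μ ⊔ linearCharacterStabilizer ν = ⊤)
    (heq : ∀ x : A, (x : G) ∈ ⁅⁅A, (⊤ : Subgroup G)⁆, (⊤ : Subgroup G)⁆ → μ x = ν x) :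
    ⁅⁅A, (⊤ : Subgroup G)⁆, ⊤⁆ ≤ ν.ker.map A.subtype := by
  have hnormal (ξ : A →* M) : (linearCharacterStabilizer ξ).Normal :=
    Subgroup.Normal.of_commutator_le G (hA.trans (le_linearCharacterStabilizer ξ))
  have hker (ξ : A →* M) : ⁅⁅A, linearCharacterStabilizer ξ⁆, ⊤⁆ ≤ ξ.ker.map A.subtype :=
    (Subgroup.commutator_le_left _ _).trans (commutator_linearCharacterStabilizer_le ξ)
  have hdecomp : ⁅⁅A, (⊤ : Subgroup G)⁆, (⊤ : Subgroup G)⁆ =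
      ⁅⁅A, linearCharacterStabilizer μ⁆, ⊤⁆ ⊔ ⁅⁅A, linearCharacterStabilizer ν⁆, ⊤⁆ := by
    rw [← commutator_sup_left, ← commutator_sup_right, hsup]
  refine hdecomp.trans_le (sup_le (fun x hx => ?_) (hker ν))
  obtain ⟨y, hy, rfl⟩ := hker μ hx
  exact ⟨y, (heq y (hdecomp.ge (le_sup_left (α := Subgroup G) hx))).symm.trans hy, rfl⟩

theorem exists_linearCharacterStabilizer_eq [CommGroup M] {p : ℕ} (hp : p.Prime)
    (hA : commutator G ≤ A) (hindex : A.index = p ^ 2) {ν : A →* M}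
    (hν : ¬ ⁅⁅A, (⊤ : Subgroup G)⁆, ⊤⁆ ≤ ν.ker.map A.subtype)
    (hθ : ∀ m ∉ A, ∃ θ : A →* M,
      (∀ x : A, (x : G) ∈ ⁅⁅A, (⊤ : Subgroup G)⁆, (⊤ : Subgroup G)⁆ → θ x = 1) ∧
        m ∉ linearCharacterStabilizer θ) :
    ∃ μ : A →* M, linearCharacterStabilizer μ = A := by
  by_contra! hne
  have hlt (ξ : A →* M) : A < linearCharacterStabilizer ξ :=
    lt_of_le_of_ne (le_linearCharacterStabilizer ξ) (hne ξ).symm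
  obtain ⟨-, m, hmν, hmA⟩ := SetLike.lt_iff_le_and_exists.mp (hlt ν)
  obtain ⟨θ, hθ1, hmθ⟩ := hθ m hmA
  have hsup : linearCharacterStabilizer (θ * ν) ⊔ linearCharacterStabilizer ν ≠ ⊤ := fun hsup =>
    hν (commutator_commutator_top_le_ker hA hsup fun x hx => by
      rw [MonoidHom.mul_apply, hθ1 x hx, one_mul])
  have hmax (ξ : A →* M) {K : Subgroup G} (hle : linearCharacterStabilizer ξ ≤ K) (hK : K ≠ ⊤) :
      linearCharacterStabilizer ξ = K := by
    have hprime := (eq_top_or_index_eq_of_index_sq hp hindex (hlt ξ)).resolve_left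
      (ne_top_of_le_ne_top hK hle)
    exact hle.eq_of_not_lt fun hlt => hK (eq_top_of_index_prime (hprime ▸ hp) hlt)
  have hstab : linearCharacterStabilizer (θ * ν) = linearCharacterStabilizer ν :=
    (hmax _ le_sup_left hsup).trans (hmax _ le_sup_right hsup).symm
  have hmθν : m ∈ linearCharacterStabilizer (θ * ν) := hstab ▸ hmν
  refine hmθ fun a => mul_right_cancel (b := ν a) ?_
  have := hmθν a
  rwa [MonoidHom.mul_apply, MonoidHom.mul_apply, hmν a] at this

end LinearCharacterStabilizer

section SeparatingCharacters

theorem exists_injective_addCircle_rat :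
    ∃ e : Multiplicative (AddCircle (1 : ℚ)) →* ℂˣ, Function.Injective e := by
  let i : AddCircle (1 : ℚ) →+ AddCircle (1 : ℝ) :=
    QuotientAddGroup.map _ _ (Rat.castHom ℝ).toAddMonoidHom (by simp)
  have hi : Function.Injective i := by
    refine (injective_iff_map_eq_zero i).mpr fun q => QuotientAddGroup.induction_on q fun q hq => ?_
    obtain ⟨n, hn⟩ := (AddCircle.coe_eq_zero_iff _).mp hq
    refine (AddCircle.coe_eq_zero_iff _).mpr ⟨n, Rat.cast_injective (α := ℝ) ?_⟩
    simpa using hn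
  refine ⟨(Circle.toUnits.comp AddCircle.toCircle_addChar.toMonoidHom).comp i.toMultiplicative, ?_⟩
  exact unitSphereToUnits_injective.comp ((AddCircle.injective_toCircle one_ne_zero).comp hi)

theorem exists_complexCharacter_apply_ne_one {B : Type*} [CommGroup B] {x : B} (hx : x ≠ 1) :
    ∃ φ : B →* ℂˣ, φ x ≠ 1 := by
  obtain ⟨c, hc⟩ := CharacterModule.exists_character_apply_ne_zero_of_ne_zero
    (A := Additive B) (a := Additive.ofMul x) hx
  obtain ⟨e, he⟩ := exists_injective_addCircle_rat
  exact ⟨e.comp (AddMonoidHom.toMultiplicativeRight c), (map_ne_one_iff e he).mpr hc⟩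

variable {A : Type*} [Group A] {N : Subgroup A} [N.Normal]

open scoped IsMulCommutative in
theorem exists_complexCharacter_ker_le (hN : commutator A ≤ N) {x : A} (hx : x ∉ N) :
    ∃ φ : A →* ℂˣ, N ≤ φ.ker ∧ φ x ≠ 1 := by
  have hcomm : IsMulCommutative (A ⧸ N) :=
    Subgroup.Normal.quotient_commutative_iff_commutator_le.mpr hN
  have hx' : (x : A ⧸ N) ≠ 1 := mt (QuotientGroup.eq_one_iff x).mp hx
  obtain ⟨φ, hφ⟩ := exists_complexCharacter_apply_ne_one hx'
  refine ⟨φ.comp (QuotientGroup.mk' N), fun n hn => ?_, hφ⟩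
  rw [MonoidHom.mem_ker, MonoidHom.comp_apply, QuotientGroup.mk'_apply,
    (QuotientGroup.eq_one_iff n).mpr hn, map_one]

theorem exists_complexCharacter_subgroup_apply_ne_one {G : Type*} [Group G] {A N : Subgroup G}
    [N.Normal] (hAN : ⁅A, A⁆ ≤ N) {x : A} (hx : (x : G) ∉ N) :
    ∃ φ : A →* ℂˣ, (∀ a : A, (a : G) ∈ N → φ a = 1) ∧ φ x ≠ 1 := by
  rw [← Subgroup.map_subtype_commutator, Subgroup.map_le_iff_le_comap] at hAN
  exact exists_complexCharacter_ker_le (N := N.comap A.subtype) hAN hx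

end SeparatingCharacters

section LowerCentralSeries

variable {G : Type*} [Group G] {p : ℕ}

local notation "γ" => lowerCentralTerm G

theorem exists_linearCharacterStabilizer_eq_lowerCentralTerm_two (hp : p.Prime)
    (hG' : (commutator G).index = p ^ 2) (hlt : p < (γ 4).relIndex (γ 3)) (hne : γ 5 ≠ γ 4) :
    ∃ μ : γ 2 →* ℂˣ, linearCharacterStabilizer μ = γ 2 := by
  have h32 : γ 3 < γ 2 := lowerCentralTerm_three_lt_two_of_lt_relIndex hp hlt
  have h42 : γ 4 ≤ γ 2 := lowerCentralTerm_antitone (by decide)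
  have h54 : γ 5 < γ 4 := lt_of_le_of_ne (lowerCentralTerm_antitone (by decide)) hne
  have hcomm : ⁅γ 2, γ 2⁆ ≤ γ 5 := commutator_lowerCentralTerm_two_le
    ((relIndex_lowerCentralTerm_three_two hp hG' h32).symm ▸ hp)
  obtain ⟨x, hx4, hx5⟩ := SetLike.exists_of_lt h54
  obtain ⟨c, hc2, hc3⟩ := SetLike.exists_of_lt h32
  obtain ⟨ν, -, hνx⟩ := exists_complexCharacter_subgroup_apply_ne_one hcomm (x := ⟨x, h42 hx4⟩) hx5
  refine exists_linearCharacterStabilizer_eq hp le_rfl hG' (ν := ν) (fun hle => ?_) fun m hm => ?_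
  · obtain ⟨y, hy, rfl⟩ := hle hx4
    exact hνx hy
  · have hcm : ⁅c, m⁆ ∉ γ 4 := by
      rwa [← mem_centralizerMod_singleton,
        centralizerMod_lowerCentralTerm_four_eq hp hG' hlt hc2 hc3]
    have hcm2 : ⁅c, m⁆ ∈ γ 2 := Subgroup.commutator_mem_commutator trivial trivial
    obtain ⟨θ, hθ, hθcm⟩ :=
      exists_complexCharacter_subgroup_apply_ne_one (hcomm.trans h54.le) (x := ⟨_, hcm2⟩) hcm
    refine ⟨θ, hθ, fun hmθ => ?_⟩
    obtain ⟨y, hy, hyx⟩ := commutator_linearCharacterStabilizer_le θ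
      (Subgroup.commutator_mem_commutator hc2 hmθ)
    exact hθcm ((congrArg θ (Subtype.ext hyx)).symm.trans hy)

theorem lowerCentralTerm_five_ne_four [Finite G] (hp : p.Prime) (hG : IsPGroup p G)
    (hindex : (γ 4).index = p ^ 5) (hcard : p ^ 6 ≤ Nat.card G) : γ 5 ≠ γ 4 := by
  have : Fact p.Prime := ⟨hp⟩
  have := hG.isNilpotent
  refine commutator_top_ne_self (H := γ 4) fun hbot => ?_
  rw [hbot, Subgroup.index_bot] at hindex
  exact (Nat.pow_lt_pow_right hp.one_lt (by decide)).not_ge (hcard.trans_eq hindex)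

end LowerCentralSeries

section Irreducible

theorem isIrreducible_of_equiv {k G V W : Type*} [Field k] [Group G] [AddCommGroup V] [Module k V]
    [AddCommGroup W] [Module k W] {ρ : Representation k G V} {σ : Representation k G W}
    (φ : ρ.Equiv σ) (hρ : ρ.IsIrreducible) : σ.IsIrreducible := by
  rw [Representation.irreducible_iff_isSimpleModule_asModule] at hρ ⊢
  exact (LinearEquiv.ofBijective
    (Representation.IntertwiningMap.equivLinearMapAsModule ρ σ φ.toIntertwiningMap)
    φ.toLinearEquiv.bijective).isSimpleModule_iff.mp hρ

theorem isIrreducibleCharacter_character {G V : Type*} [Group G] [AddCommGroup V] [Module ℂ V]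
    [FiniteDimensional ℂ V] {ρ : Representation ℂ G V} (hρ : ρ.IsIrreducible) :
    IsIrreducibleCharacter ρ.character := by
  let e : V ≃ₗ[ℂ] (Fin (Module.finrank ℂ V) → ℂ) := (Module.finBasis ℂ V).equivFun
  let σ : Representation ℂ G (Fin (Module.finrank ℂ V) → ℂ) := e.conjRingEquiv.toMonoidHom.comp ρ
  let φ : ρ.Equiv σ := .mk e fun g => by
    ext v
    simp [σ]
  exact ⟨_, σ, isIrreducible_of_equiv φ hρ, (Representation.char_iso φ).symm⟩

theorem single_mem_of_separating {k ι : Type*} [Field k] [Finite ι] [DecidableEq ι]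
    {U : Submodule k (ι → k)}
    (hsep : ∀ i j, i ≠ j → ∃ s : ι → k, (∀ f ∈ U, s * f ∈ U) ∧ s i ≠ s j)
    {f : ι → k} (hf : f ∈ U) {i : ι} (hi : f i ≠ 0) : Pi.single i 1 ∈ U := by
  have := Fintype.ofFinite ι
  have hvanish (t : Finset ι) (hit : i ∉ t) : ∃ f ∈ U, f i ≠ 0 ∧ ∀ j ∈ t, f j = 0 := by
    induction t using Finset.induction_on with
    | empty => exact ⟨f, hf, hi, by simp⟩
    | insert j t _ ih =>
      rw [Finset.mem_insert, not_or] at hit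
      obtain ⟨f, hf, hfi, hft⟩ := ih hit.2
      obtain ⟨s, hsU, hs⟩ := hsep i j hit.1
      -- The factor `s - s j` kills the coordinate `j` and keeps the coordinate `i`.
      refine ⟨s * f - s j • f, U.sub_mem (hsU f hf) (U.smul_mem _ hf), ?_, ?_⟩
      · simpa [← sub_mul, sub_eq_zero] using ⟨hs, hfi⟩
      · simp +contextual [hft]
  obtain ⟨f, hf, hfi, hf0⟩ := hvanish (Finset.univ.erase i) (Finset.notMem_erase i _)
  have hsingle : f = f i • Pi.single i 1 := by
    ext j
    obtain rfl | hj := eq_or_ne j i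
    · simp
    · simp [hj, hf0]
  rw [hsingle] at hf
  exact (U.smul_mem_iff hfi).mp hf

theorem isIrreducible_of_separating {k G V ι : Type*} [Field k] [Group G] [AddCommGroup V]
    [Module k V] [Finite ι] [Nonempty ι] {ρ : Representation k G V} (e : V ≃ₗ[k] (ι → k))
    (hsep : ∀ i j, i ≠ j → ∃ (g : G) (s : ι → k), (∀ v, e (ρ g v) = s * e v) ∧ s i ≠ s j)
    (hreach : ∀ v ≠ 0, ∀ i, ∃ g, e (ρ g v) i ≠ 0) : ρ.IsIrreducible where
  exists_pair_ne := by
    have : Nontrivial V := e.toEquiv.nontrivial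
    exact ⟨⊥, ⊤, fun h => bot_ne_top (α := Submodule k V) (congrArg (·.toSubmodule) h)⟩
  eq_bot_or_eq_top U := by
    classical
    refine or_iff_not_imp_left.mpr fun hU => Subrepresentation.toSubmodule_injective ?_
    obtain ⟨v, hvU, hv⟩ := Submodule.exists_mem_ne_zero_of_ne_bot
      (mt (Subrepresentation.toSubmodule_injective (a₂ := ⊥)) hU)
    have hsingle (i : ι) : Pi.single i 1 ∈ U.toSubmodule.map (e : V →ₗ[k] (ι → k)) := by
      obtain ⟨g, hg⟩ := hreach v hv i
      refine single_mem_of_separating (fun i j hij => ?_)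
        (Submodule.mem_map_of_mem (U.apply_mem_toSubmodule g hvU)) hg
      obtain ⟨h, s, hs, hsij⟩ := hsep i j hij
      refine ⟨s, ?_, hsij⟩
      rintro _ ⟨w, hw, rfl⟩
      exact ⟨ρ h w, U.apply_mem_toSubmodule h hw, hs w⟩
    have htop : U.toSubmodule.map (e : V →ₗ[k] (ι → k)) = ⊤ := by
      rw [← top_le_iff, ← (Pi.basisFun k ι).span_eq, Submodule.span_le, Set.range_subset_iff]
      exact fun i => (Pi.basisFun_apply k ι i).symm ▸ hsingle i
    exact Submodule.map_eq_top_iff.mp htop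

end Irreducible

section LinearCharacter

variable {k G : Type*} [Field k] [Group G] {N : Subgroup G}

/-- The one-dimensional representation given by a linear character. -/
def linearCharacterRep {A : Type*} [Group A] (μ : A →* kˣ) : Representation k A k where
  toFun a := LinearMap.mulLeft k (μ a : k)
  map_one' := by
    ext
    simp
  map_mul' a b := by
    ext
    simp

@[simp]
theorem linearCharacterRep_apply {A : Type*} [Group A] (μ : A →* kˣ) (a : A) (z : k) :
    linearCharacterRep μ a z = μ a * z := rfl

/-- The representation of `G` coinduced from a linear character `μ` of a subgroup `N`. Its elements
are the functions `f : G → k` with `f (a * g) = μ a * f g` for `a ∈ N`, and `G` acts by right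
translation. When `N` has finite index this is the induced representation. -/
abbrev coindLinearCharacter (μ : N →* kˣ) :
    Representation k G (Representation.coindV N.subtype (linearCharacterRep μ)) :=
  Representation.coind N.subtype (linearCharacterRep μ)

variable [N.Normal] (μ : N →* kˣ)

theorem mul_out_inv_mem (g : G) : g * (g : G ⧸ N).out⁻¹ ∈ N := by
  rw [← div_eq_mul_inv, ← QuotientGroup.eq_iff_div_mem, QuotientGroup.out_eq']

/-- Evaluation at coset representatives identifies the coinduced representation space with the
space of functions on `G ⧸ N`. -/
noncomputable def coindVEquivQuotient :
    Representation.coindV N.subtype (linearCharacterRep μ) ≃ₗ[k] (G ⧸ N → k) where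
  toFun f q := f.1 q.out
  map_add' _ _ := rfl
  map_smul' _ _ := rfl
  invFun φ := ⟨fun g => μ ⟨_, mul_out_inv_mem g⟩ * φ g, fun a g => by
    have hq : ((a * g : G) : G ⧸ N) = g := by
      rw [QuotientGroup.mk_mul, (QuotientGroup.eq_one_iff (a : G)).mpr a.2, one_mul]
    have ha : (⟨_, mul_out_inv_mem (a * g)⟩ : N) = a * ⟨_, mul_out_inv_mem g⟩ := by
      ext
      simp only [hq, Subgroup.coe_mul, mul_assoc]
    simp only [Subgroup.subtype_apply, linearCharacterRep_apply]
    rw [ha, hq, map_mul, Units.val_mul, mul_assoc]⟩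
  left_inv f := by
    ext g
    refine (f.2 ⟨_, mul_out_inv_mem g⟩ (g : G ⧸ N).out).symm.trans (congrArg f.1 ?_)
    exact inv_mul_cancel_right g _
  right_inv φ := by
    ext q
    have hone : (⟨_, mul_out_inv_mem q.out⟩ : N) = 1 := by
      ext
      simp
    simp only
    rw [hone, map_one, Units.val_one, one_mul, QuotientGroup.out_eq']

theorem coindVEquivQuotient_coind_apply (a : N) (f) (q : G ⧸ N) :
    coindVEquivQuotient μ (coindLinearCharacter μ a f) q =
      μ (MulAut.conjNormal q.out a) * coindVEquivQuotient μ f q := by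
  refine Eq.trans (congrArg f.1 ?_) (f.2 (MulAut.conjNormal q.out a) q.out)
  simp

variable {μ}

theorem coindLinearCharacter_isIrreducible [N.FiniteIndex] (hμ : linearCharacterStabilizer μ ≤ N) :
    (coindLinearCharacter μ).IsIrreducible := by
  refine isIrreducible_of_separating (coindVEquivQuotient μ) (fun q r hqr => ?_) fun f hf q => ?_
  · have hN : q.out * r.out⁻¹ ∉ N := by
      rwa [← div_eq_mul_inv, ← QuotientGroup.eq_iff_div_mem, QuotientGroup.out_eq',
        QuotientGroup.out_eq']
    obtain ⟨a, ha⟩ := not_forall.mp (mt (@hμ (q.out * r.out⁻¹)) hN)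
    refine ⟨(MulAut.conjNormal r.out⁻¹ a : N), fun s => μ (MulAut.conjNormal s.out
      (MulAut.conjNormal r.out⁻¹ a)), fun f => ?_, ?_⟩
    · exact funext (coindVEquivQuotient_coind_apply μ _ f)
    · simp only [← MulAut.mul_apply, ← map_mul, mul_inv_cancel]
      simpa [Units.val_inj] using ha
  · obtain ⟨g, hg⟩ : ∃ g, f.1 g ≠ 0 := Function.ne_iff.mp fun h => hf (Subtype.ext h)
    refine ⟨q.out⁻¹ * g, ?_⟩
    change f.1 (q.out * (q.out⁻¹ * g)) ≠ 0
    rwa [mul_inv_cancel_left]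

theorem exists_isIrreducibleCharacter_apply_one_eq_index {N : Subgroup G} [N.Normal]
    [N.FiniteIndex] {μ : N →* ℂˣ} (hμ : linearCharacterStabilizer μ ≤ N) :
    ∃ χ : G → ℂ, IsIrreducibleCharacter χ ∧ χ 1 = N.index := by
  have := Fintype.ofFinite (G ⧸ N)
  have := Module.Finite.equiv (coindVEquivQuotient μ).symm
  refine ⟨_, isIrreducibleCharacter_character (coindLinearCharacter_isIrreducible hμ), ?_⟩
  rw [Representation.char_one, (coindVEquivQuotient μ).finrank_eq,
    Module.finrank_fintype_fun_eq_card, Subgroup.index_eq_card, Nat.card_eq_fintype_card]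

end LinearCharacter

theorem theorem3_general {G : Type*} [Group G] (p : ℕ) (hp : p.Prime)
    (hG' : (commutator G).index = p ^ 2) :
    (p < (lowerCentralTerm G 4).relIndex (lowerCentralTerm G 3) ↔
      (lowerCentralTerm G 4).index = p ^ 5) ∧
    (p < (lowerCentralTerm G 4).relIndex (lowerCentralTerm G 3) →
      lowerCentralTerm G 5 ≠ lowerCentralTerm G 4 →
      ∃ χ : G → ℂ, IsIrreducibleCharacter χ ∧ χ 1 = (p : ℂ) ^ 2) := by
  refine ⟨lt_relIndex_lowerCentralTerm_iff hp hG', fun hlt hne => ?_⟩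
  obtain ⟨μ, hμ⟩ := exists_linearCharacterStabilizer_eq_lowerCentralTerm_two hp hG' hlt hne
  have hindex : (lowerCentralTerm G 2).index = p ^ 2 := hG'
  have : (lowerCentralTerm G 2).FiniteIndex := ⟨hindex ▸ pow_ne_zero 2 hp.ne_zero⟩
  obtain ⟨χ, hχ, hχ1⟩ := exists_isIrreducibleCharacter_apply_one_eq_index hμ.le
  exact ⟨χ, hχ, by rw [hχ1, hindex, Nat.cast_pow]⟩

theorem theorem3 {G : Type*} [Group G] [Finite G] (p : ℕ) (hp : p.Prime) (hG : IsPGroup p G)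
    (hG' : (commutator G).index = p ^ 2) (hcard : p ^ 6 ≤ Nat.card G) :
    (p < (lowerCentralTerm G 4).relIndex (lowerCentralTerm G 3) ↔
      (lowerCentralTerm G 4).index = p ^ 5) ∧
    (p < (lowerCentralTerm G 4).relIndex (lowerCentralTerm G 3) →
      ∃ χ : G → ℂ, IsIrreducibleCharacter χ ∧ χ 1 = (p : ℂ) ^ 2) := by
  obtain ⟨hiff, hχ⟩ := theorem3_general p hp hG'
  exact ⟨hiff, fun hlt => hχ hlt
    (lowerCentralTerm_five_ne_four hp hG (hiff.mp hlt) hcard)⟩
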